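/- Let $\mathcal A,\mathcal B$ be finite sets, $A\in\mathbb R^{\mathcal A\times\mathcal B}$, $\|A\|_\infty=\max_{a,b}|A_{a,b}|$ and $\tau>0$. Write $\Delta(\cdot)$ for the probability simplex, $\mathcal H(\pi)=-\sum_i\pi_i\log\pi_i$, and $f_\tau(\mu,\nu)=\mu^\top A\nu+\tau\mathcal H(\mu)-\tau\mathcal H(\nu)$. Let $\zeta^\star_\tau=(\mu^\star_\tau,\nu^\star_\tau)$ be the solution of $\max_{\mu\in\Delta(\mathcal A)}\min_{\nu\in\Delta(\mathcal B)}f_\tau(\mu,\nu)$ (the quantal response equilibrium). For $\zeta=(\mu,\nu)$ and $\zeta'=(\mu',\nu')$ let $\mathsf{KL}(\zeta\|\zeta')=\sum_a\mu(a)\log\frac{\mu(a)}{\mu'(a)}+\sum_b\nu(b)\log\frac{\nu(b)}{\nu'(b)}$, let $\log\frac{\zeta}{\zeta'}$ be the vector of the entrywise log-ratios $\log\frac{\mu(a)}{\mu'(a)}$ $(a\in\mathcal A)$ and $\log\frac{\nu(b)}{\nu'(b)}$ $(b\in\mathcal B)$, and let $$\mathsf{OptGap}_\tau(\zeta)=|f_\tau(\mu,\nu)-f_\tau(\mu^\star_\tau,\nu^\star_\tau)|,\qquad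 \mathsf{DualGap}_\tau(\zeta)=\max_{\mu'\in\Delta(\mathcal A)}f_\tau(\mu',\nu)-\min_{\nu'\in\Delta(\mathcal B)}f_\tau(\mu,\nu').$$ For a step $\eta>0$ and pairs $\zeta=(\mu,\nu)$, $z=(z_1,z_2)$, let $U_\eta(\zeta,z)\in\Delta(\mathcal A)\times\Delta(\mathcal B)$ be the pair $(\mu^+,\nu^+)$ with $$\mu^+(a)\propto\mu(a)^{1-\eta\tau}\exp(\eta[Az_2]_a),\qquad \nu^+(b)\propto\nu(b)^{1-\eta\tau}\exp(-\eta[A^\top z_1]_b).$$ Let $\zeta^{(0)}=(\mu^{(0)},\nu^{(0)})\in\Delta(\mathcal A)\times\Delta(\mathcal B)$ have positive entries. PU (predictive update) with constant step $\eta$ is, for $t\ge 0$, $$\bar\zeta^{(t+1)}=U_\eta(\zeta^{(t)},\zeta^{(t)}),\qquad \zeta^{(t+1)}=U_\eta(\zeta^{(t)},\bar\zeta^{(t+1)}).$$ OMWU (optimistic multiplicative weights update) with constant step $\eta$ starts from $\bar\zeta^{(0)}=\zeta^{(0)}$ and is, for $t\ge 0$, $$\bar\zeta^{(t+1)}=U_\eta(\zeta^{(t)},\bar\zeta^{(t)}),\qquad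 \zeta^{(t+1)}=U_\eta(\zeta^{(t)},\bar\zeta^{(t+1)}).$$ **Theorem (last-iterate convergence of PU and OMWU).** Suppose that $0<\eta\le\frac1{\tau+2\|A\|_\infty}$ in the case of PU, and $0<\eta\le\min\{\frac1{2\tau+2\|A\|_\infty},\frac1{4\|A\|_\infty}\}$ in the case of OMWU, where $\frac1{4\|A\|_\infty}$ is read as $+\infty$ if $A=0$. Then the iterates of both methods satisfy, for every $t\ge0$, $$\max\bigl\{\mathsf{KL}(\zeta^\star_\tau\|\zeta^{(t)}),\ \tfrac12\mathsf{KL}(\zeta^\star_\tau\|\bar\zeta^{(t+1)})\bigr\}\le(1-\eta\tau)^t\,\mathsf{KL}(\zeta^\star_\tau\|\zeta^{(0)}),$$ $$\Bigl\|\log\frac{\zeta^{(t)}}{\zeta^\star_\tau}\Bigr\|_\infty\le2(1-\eta\tau)^t\Bigl\|\log\frac{\zeta^{(0)}}{\zeta^\star_\tau}\Bigr\|_\infty+\frac{8\|A\|_\infty}{\tau}(1-\eta\tau)^{t/2}\,\mathsf{KL}(\zeta^\star_\tau\|\zeta^{(0)})^{1/2},$$ and, for every $t\ge1$, $$\mathsf{OptGap}_\tau(\bar\zeta^{(t)})\le3\eta^{-1}(1-\eta\tau)^t\,\mathsf{KL}(\zeta^\star_\tau\|\zeta^{(0)}),$$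 $$\mathsf{DualGap}_\tau(\bar\zeta^{(t)})\le\bigl(\eta^{-1}+2\tau^{-1}\|A\|_\infty^2\bigr)(1-\eta\tau)^{t-1}\,\mathsf{KL}(\zeta^\star_\tau\|\zeta^{(0)}).$$ -/

import Mathlib

open scoped Matrix BigOperators

noncomputable section

namespace EntropyGame

variable {α β : Type*} [Fintype α] [Fintype β]

/-- Entrywise maximum norm `max_{i,j} |A i j|` of a matrix. -/
def maxNorm (A : Matrix α β ℝ) : ℝ := ⨆ p : α × β, |A p.1 p.2|

/-- Shannon entropy of a vector of probabilities. -/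
def entropy (p : α → ℝ) : ℝ := -∑ a, p a * Real.log (p a)

/-- Kullback-Leibler divergence of two distributions on a finite set (used for `q` with
positive entries). -/
def kl (p q : α → ℝ) : ℝ := ∑ a, p a * Real.log (p a / q a)

/-- `KL(ζ ‖ ζ') = KL(μ ‖ μ') + KL(ν ‖ ν')` for pairs `ζ = (μ, ν)`, `ζ' = (μ', ν')`. -/
def klPair (ζ ζ' : (α → ℝ) × (β → ℝ)) : ℝ := kl ζ.1 ζ'.1 + kl ζ.2 ζ'.2

/-- The entropy-regularized payoff `μᵀ A ν + τ H(μ) - τ H(ν)`. -/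
def payoff (A : Matrix α β ℝ) (τ : ℝ) (μ : α → ℝ) (ν : β → ℝ) : ℝ :=
  μ ⬝ᵥ (A *ᵥ ν) + τ * entropy μ - τ * entropy ν

/-- `ζ = (μ, ν)` is an optimal solution of `max_μ min_ν payoff A τ μ ν` over the product of the
probability simplices: `μ` maximizes the inner minimum, and `ν` attains the inner minimum
at `μ`. For `τ > 0` this is the quantal response equilibrium. -/
def IsQRE (A : Matrix α β ℝ) (τ : ℝ) (ζ : (α → ℝ) × (β → ℝ)) : Prop :=
  ζ.1 ∈ stdSimplex ℝ α ∧ ζ.2 ∈ stdSimplex ℝ β ∧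
    IsMaxOn (fun μ : α → ℝ => ⨅ ν : stdSimplex ℝ β, payoff A τ μ ν) (stdSimplex ℝ α) ζ.1 ∧
    IsMinOn (fun ν : β → ℝ => payoff A τ ζ.1 ν) (stdSimplex ℝ β) ζ.2

/-- `max_{μ'} payoff(μ', ν) - min_{ν'} payoff(μ, ν')`, over the probability simplices. -/
def dualGap (A : Matrix α β ℝ) (τ : ℝ) (ζ : (α → ℝ) × (β → ℝ)) : ℝ :=
  (⨆ μ' : stdSimplex ℝ α, payoff A τ μ' ζ.2) - ⨅ ν' : stdSimplex ℝ β, payoff A τ ζ.1 ν'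

/-- `|payoff(ζ) - payoff(ζs)|`, to be used with `ζs` the quantal response equilibrium. -/
def optGap (A : Matrix α β ℝ) (τ : ℝ) (ζs ζ : (α → ℝ) × (β → ℝ)) : ℝ :=
  |payoff A τ ζ.1 ζ.2 - payoff A τ ζs.1 ζs.2|

/-- The entrywise log-ratios `log (ζ / ζ')`. The norm on this product of function spaces is
the `ℓ∞` norm over all the coordinates of both components. -/
def logRatio (ζ ζ' : (α → ℝ) × (β → ℝ)) : (α → ℝ) × (β → ℝ) :=
  (fun a => Real.log (ζ.1 a / ζ'.1 a), fun b => Real.log (ζ.2 b / ζ'.2 b))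

/-- The probability vector proportional to `p a ^ (1 - η τ) * exp (η * g a)`. -/
def mwu (τ η : ℝ) (p g : α → ℝ) : α → ℝ := fun a =>
  p a ^ (1 - η * τ) * Real.exp (η * g a) / ∑ a', p a' ^ (1 - η * τ) * Real.exp (η * g a')

/-- One regularized multiplicative update of both players from `ζ = (μ, ν)`, the gradients
being evaluated at `z = (z₁, z₂)`: the new pair is proportional to
`μ ^ (1 - η τ) * exp (η A z₂)` and `ν ^ (1 - η τ) * exp (- η Aᵀ z₁)`. -/
def pairUpdate (A : Matrix α β ℝ) (τ η : ℝ) (ζ z : (α → ℝ) × (β → ℝ)) : (α → ℝ) × (β → ℝ) :=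
  (mwu τ η ζ.1 (A *ᵥ z.2), mwu τ η ζ.2 (-(Aᵀ *ᵥ z.1)))

/-- `ζ` and `ζbar` are the iterates of the predictive update method with constant step `η`.
The method has no midpoint of index `0`, and `ζbar 0` is not used. -/
def IsPU (A : Matrix α β ℝ) (τ η : ℝ) (ζ ζbar : ℕ → (α → ℝ) × (β → ℝ)) : Prop :=
  ∀ t, ζbar (t + 1) = pairUpdate A τ η (ζ t) (ζ t) ∧
    ζ (t + 1) = pairUpdate A τ η (ζ t) (ζbar (t + 1))

/-- `ζ` and `ζbar` are the iterates of the optimistic multiplicative weights update method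
with constant step `η`. -/
def IsOMWU (A : Matrix α β ℝ) (τ η : ℝ) (ζ ζbar : ℕ → (α → ℝ) × (β → ℝ)) : Prop :=
  ζbar 0 = ζ 0 ∧
    ∀ t, ζbar (t + 1) = pairUpdate A τ η (ζ t) (ζbar t) ∧
      ζ (t + 1) = pairUpdate A τ η (ζ t) (ζbar (t + 1))

end EntropyGame

end

namespace EntropyGame

/-! At the equilibrium `τ log μ⋆ = A ν⋆ + c` and `τ log ν⋆ = -Aᵀ μ⋆ + d` (`IsQRE.isGibbsPair`).
Substituted into an update from `ζ` to `ζ'` with gradients at `z`, these equations make the new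
logarithms a convex combination of those of `ζ` and `ζ⋆`, plus a gradient term linear in `z - ζ⋆`
and a constant. Pairing with `z - ζ⋆` kills the gradient term, because the coupling of the two
players is skew, and leaves the exact identity `klPair_pairUpdate`. It would be a contraction by `1
- ητ` but for the error `KL(z ‖ ζ')`.

Since `z` and `ζ'` are updates from the same point, a three-point identity and Pinsker's inequality
bound that error by divergences that a small step absorbs (`pu_step`). For OMWU the stale gradient
leaves one more term, carried by a Lyapunov function (`omwu_step`).

The remaining bounds follow from the resulting `KLBounds`. The payoff is quadratic around the
equilibrium, up to KL terms (`IsGibbsPair.payoff_sub`), which controls both gaps. The log-ratios,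
modulo additive constants, obey a linear recursion forced by `‖z - ζ⋆‖₁`, which decays like the
square root of the divergence. -/

lemma maxNorm_nonneg {α β : Type*} (A : Matrix α β ℝ) : 0 ≤ maxNorm A :=
  Real.iSup_nonneg fun _ => abs_nonneg _

lemma maxNorm_transpose {α β : Type*} (A : Matrix α β ℝ) : maxNorm Aᵀ = maxNorm A :=
  (Equiv.prodComm β α).iSup_congr fun _ => rfl

variable {α β : Type*} [Fintype α] [Fintype β]

/-- A probability vector with positive entries. -/
def IsPosProb (p : α → ℝ) : Prop := (∀ a, 0 < p a) ∧ ∑ a, p a = 1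

/-- The `ℓ¹` norm of a finite real vector. -/
def l1 (u : α → ℝ) : ℝ := ∑ a, |u a|

lemma IsPosProb.mem {p : α → ℝ} (h : IsPosProb p) : p ∈ stdSimplex ℝ α :=
  ⟨fun a => (h.1 a).le, h.2⟩

lemma nonempty_of_mem_stdSimplex {p : α → ℝ} (h : p ∈ stdSimplex ℝ α) : Nonempty α := by
  by_contra hne
  have := not_nonempty_iff.mp hne
  simpa using h.2

lemma l1_nonneg (u : α → ℝ) : 0 ≤ l1 u := Finset.sum_nonneg fun _ _ => abs_nonneg _

lemma l1_add_le (u v : α → ℝ) : l1 (u + v) ≤ l1 u + l1 v := by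
  unfold l1
  rw [← Finset.sum_add_distrib]
  exact Finset.sum_le_sum fun a _ => abs_add_le _ _

lemma l1_sub_comm (u v : α → ℝ) : l1 (u - v) = l1 (v - u) := by
  unfold l1
  exact Finset.sum_congr rfl fun a _ => abs_sub_comm _ _

lemma abs_apply_le_maxNorm (A : Matrix α β ℝ) (a : α) (b : β) : |A a b| ≤ maxNorm A :=
  le_ciSup (f := fun p : α × β => |A p.1 p.2|) (Set.finite_range _).bddAbove (a, b)

lemma abs_mulVec_le (A : Matrix α β ℝ) (v : β → ℝ) (a : α) :
    |(A *ᵥ v) a| ≤ maxNorm A * l1 v := by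
  unfold Matrix.mulVec dotProduct l1
  rw [Finset.mul_sum]
  refine (Finset.abs_sum_le_sum_abs _ _).trans (Finset.sum_le_sum fun b _ => ?_)
  rw [abs_mul]
  exact mul_le_mul_of_nonneg_right (abs_apply_le_maxNorm A a b) (abs_nonneg _)

lemma abs_dotProduct_mulVec_le (A : Matrix α β ℝ) (u : α → ℝ) (v : β → ℝ) :
    |u ⬝ᵥ (A *ᵥ v)| ≤ maxNorm A * (l1 u * l1 v) := by
  have h : |u ⬝ᵥ (A *ᵥ v)| ≤ l1 u * (maxNorm A * l1 v) := by
    unfold dotProduct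
    rw [l1, Finset.sum_mul]
    refine (Finset.abs_sum_le_sum_abs _ _).trans (Finset.sum_le_sum fun a _ => ?_)
    rw [abs_mul]
    exact mul_le_mul_of_nonneg_left (abs_mulVec_le A v a) (abs_nonneg _)
  linarith

/-! ### Pinsker's inequality -/

lemma two_mul_sub_one_le_add_one_mul_log {x : ℝ} (hx : 1 ≤ x) :
    2 * (x - 1) ≤ (x + 1) * Real.log x := by
  have h := Real.le_log_one_add_of_nonneg (x := x - 1) (by linarith)
  rw [div_le_iff₀ (by linarith)] at h
  have e : (1 : ℝ) + (x - 1) = x := by ring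
  rw [e] at h
  linarith

lemma add_one_mul_log_le_two_mul_sub_one {x : ℝ} (hx : 0 < x) (hx1 : x ≤ 1) :
    (x + 1) * Real.log x ≤ 2 * (x - 1) := by
  have h := two_mul_sub_one_le_add_one_mul_log (one_le_inv_iff₀.mpr ⟨hx, hx1⟩)
  rw [Real.log_inv] at h
  have h' := mul_le_mul_of_nonneg_left h hx.le
  have e1 : x * (2 * (x⁻¹ - 1)) = 2 * (1 - x) := by field_simp
  have e2 : x * ((x⁻¹ + 1) * -Real.log x) = -((x + 1) * Real.log x) := by field_simp; ring
  rw [e1, e2] at h'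
  linarith

/-- The difference of the two sides vanishes at `1`, and its derivative `4 ((x + 1) log x - 2 (x -
1))` has the sign of `x - 1`. This is the pointwise form of Pinsker's inequality with `x = p / q`.
-/
lemma three_mul_sq_sub_one_le {x : ℝ} (hx : 0 ≤ x) :
    3 * (x - 1) ^ 2 ≤ 2 * (x + 2) * (x * Real.log x - x + 1) := by
  set F : ℝ → ℝ := fun x => 2 * (x + 2) * (x * Real.log x - x + 1) - 3 * (x - 1) ^ 2 with hF
  have hcont : Continuous F := by
    have := Real.continuous_mul_log
    fun_prop
  have hd : ∀ y : ℝ, 0 < y →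
      HasDerivAt F (4 * ((y + 1) * Real.log y - 2 * (y - 1))) y := by
    intro y hy
    have h1 := ((((hasDerivAt_id y).add_const 2).const_mul 2).mul
      (((Real.hasDerivAt_mul_log hy.ne').sub (hasDerivAt_id y)).add_const 1)).sub
      ((((hasDerivAt_id y).sub_const 1).pow 2).const_mul 3)
    refine h1.congr_deriv ?_
    simp
    ring
  have h1 : F 1 = 0 := by simp [hF]
  suffices 0 ≤ F x by simp only [hF] at this; linarith
  rcases le_total x 1 with h | h
  · have hm : AntitoneOn F (Set.Icc 0 1) := by
      refine antitoneOn_of_deriv_nonpos (convex_Icc 0 1) hcont.continuousOn ?_ ?_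
      · intro y hy
        rw [interior_Icc] at hy
        exact (hd y hy.1).differentiableAt.differentiableWithinAt
      · intro y hy
        rw [interior_Icc] at hy
        rw [(hd y hy.1).deriv]
        linarith [add_one_mul_log_le_two_mul_sub_one hy.1 hy.2.le]
    have := hm ⟨hx, h⟩ ⟨zero_le_one, le_rfl⟩ h
    linarith
  · have hm : MonotoneOn F (Set.Ici 1) := by
      refine monotoneOn_of_deriv_nonneg (convex_Ici 1) hcont.continuousOn ?_ ?_
      · intro y hy
        rw [interior_Ici] at hy
        exact (hd y (zero_lt_one.trans hy)).differentiableAt.differentiableWithinAt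
      · intro y hy
        rw [interior_Ici] at hy
        rw [(hd y (zero_lt_one.trans hy)).deriv]
        linarith [two_mul_sub_one_le_add_one_mul_log (le_of_lt hy)]
    have := hm (Set.self_mem_Ici) h h
    linarith

lemma sq_sub_le_mul_log_div {p q : ℝ} (hp : 0 ≤ p) (hq : 0 < q) :
    (p - q) ^ 2 ≤ (2 / 3 * (p + 2 * q)) * (p * Real.log (p / q) - p + q) := by
  have h := three_mul_sq_sub_one_le (div_nonneg hp hq.le)
  have h' := mul_le_mul_of_nonneg_left h (sq_nonneg q)
  have e1 : q ^ 2 * (3 * (p / q - 1) ^ 2) = 3 * (p - q) ^ 2 := by field_simp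
  have e2 : q ^ 2 * (2 * (p / q + 2) * (p / q * Real.log (p / q) - p / q + 1)) =
      2 * (p + 2 * q) * (p * Real.log (p / q) - p + q) := by field_simp
  rw [e1, e2] at h'
  linarith

/-- Pinsker's inequality on a finite set. -/
lemma sq_l1_sub_le_two_mul_kl {p q : α → ℝ} (hp : p ∈ stdSimplex ℝ α) (hq : IsPosProb q) :
    l1 (p - q) ^ 2 ≤ 2 * kl p q := by
  have hw : ∀ a, 0 < 2 / 3 * (p a + 2 * q a) := fun a => by
    have := hp.1 a; have := hq.1 a; linarith
  -- Cauchy-Schwarz with weights `2/3 (p + 2q)`: they match the pointwise inequality and have total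
  -- mass `2`, the constant in Pinsker's inequality.
  have h := Finset.sq_sum_div_le_sum_sq_div Finset.univ (fun a => |p a - q a|)
    (g := fun a => 2 / 3 * (p a + 2 * q a)) (fun a _ => hw a)
  have hsum : ∑ a, 2 / 3 * (p a + 2 * q a) = 2 := by
    rw [← Finset.mul_sum, Finset.sum_add_distrib, ← Finset.mul_sum, hp.2, hq.2]; norm_num
  have hle : ∑ a, |p a - q a| ^ 2 / (2 / 3 * (p a + 2 * q a)) ≤ kl p q := by
    have : kl p q = ∑ a, (p a * Real.log (p a / q a) - p a + q a) := by
      rw [Finset.sum_add_distrib, Finset.sum_sub_distrib, hp.2, hq.2, kl]; ring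
    rw [this]
    refine Finset.sum_le_sum fun a _ => ?_
    rw [div_le_iff₀ (hw a), sq_abs, mul_comm (_ + _)]
    exact sq_sub_le_mul_log_div (hp.1 a) (hq.1 a)
  rw [hsum] at h
  have e : l1 (p - q) = ∑ a, |p a - q a| := rfl
  rw [e]
  linarith

lemma kl_nonneg {p q : α → ℝ} (hp : p ∈ stdSimplex ℝ α) (hq : IsPosProb q) : 0 ≤ kl p q := by
  have := sq_l1_sub_le_two_mul_kl hp hq
  have := sq_nonneg (l1 (p - q))
  linarith

lemma kl_self (p : α → ℝ) : kl p p = 0 := by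
  refine Finset.sum_eq_zero fun a _ => ?_
  rcases eq_or_ne (p a) 0 with h | h <;> simp [h]

lemma eq_of_kl_nonpos {p q : α → ℝ} (hp : p ∈ stdSimplex ℝ α) (hq : IsPosProb q)
    (h : kl p q ≤ 0) : p = q := by
  have h1 := sq_l1_sub_le_two_mul_kl hp hq
  have h2 : l1 (p - q) = 0 := by
    have := sq_nonneg (l1 (p - q))
    exact pow_eq_zero_iff two_ne_zero |>.mp (by linarith)
  rw [l1, Finset.sum_eq_zero_iff_of_nonneg fun _ _ => abs_nonneg _] at h2
  funext a
  have := abs_eq_zero.mp (h2 a (Finset.mem_univ a))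
  simpa [sub_eq_zero] using this

lemma kl_eq_sub {p q : α → ℝ} (hq : ∀ a, 0 < q a) :
    kl p q = ∑ a, p a * Real.log (p a) - ∑ a, p a * Real.log (q a) := by
  rw [kl, ← Finset.sum_sub_distrib]
  refine Finset.sum_congr rfl fun a _ => ?_
  rcases eq_or_ne (p a) 0 with h | h
  · simp [h]
  · rw [Real.log_div h (hq a).ne', mul_sub]

/-! ### The multiplicative update -/

lemma mwu_pos [Nonempty α] (τ η : ℝ) {p : α → ℝ} (hp : ∀ a, 0 < p a) (g : α → ℝ) :
    IsPosProb (mwu τ η p g) := by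
  have hn : ∀ a, 0 < p a ^ (1 - η * τ) * Real.exp (η * g a) := fun a =>
    mul_pos (Real.rpow_pos_of_pos (hp a) _) (Real.exp_pos _)
  have hs : 0 < ∑ a, p a ^ (1 - η * τ) * Real.exp (η * g a) :=
    Finset.sum_pos (fun a _ => hn a) Finset.univ_nonempty
  refine ⟨fun a => div_pos (hn a) hs, ?_⟩
  unfold mwu
  rw [← Finset.sum_div, div_self hs.ne']

lemma exists_log_mwu [Nonempty α] (τ η : ℝ) {p : α → ℝ} (hp : ∀ a, 0 < p a) (g : α → ℝ) :
    ∃ c, ∀ a, Real.log (mwu τ η p g a) = (1 - η * τ) * Real.log (p a) + η * g a + c := by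
  have hn : ∀ a, 0 < p a ^ (1 - η * τ) * Real.exp (η * g a) := fun a =>
    mul_pos (Real.rpow_pos_of_pos (hp a) _) (Real.exp_pos _)
  have hs : 0 < ∑ a, p a ^ (1 - η * τ) * Real.exp (η * g a) :=
    Finset.sum_pos (fun a _ => hn a) Finset.univ_nonempty
  refine ⟨-Real.log (∑ a, p a ^ (1 - η * τ) * Real.exp (η * g a)), fun a => ?_⟩
  unfold mwu
  rw [Real.log_div (hn a).ne' hs.ne', Real.log_mul (Real.rpow_pos_of_pos (hp a) _).ne'
    (Real.exp_pos _).ne', Real.log_exp, Real.log_rpow (hp a)]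
  ring

lemma continuous_mwu [Nonempty α] (τ η : ℝ) {p : α → ℝ} (hp : ∀ a, 0 < p a) :
    Continuous (mwu τ η p) := by
  refine continuous_pi fun a => ?_
  unfold mwu
  refine Continuous.div (by fun_prop) (by fun_prop) fun g => ?_
  exact (Finset.sum_pos (fun a _ => mul_pos (Real.rpow_pos_of_pos (hp a) _) (Real.exp_pos _))
    Finset.univ_nonempty).ne'

/-! ### The quantal response equilibrium -/

/-- The Gibbs distribution proportional to `exp (g / τ)`. -/
noncomputable def gibbs (τ : ℝ) (g : α → ℝ) : α → ℝ := mwu τ τ⁻¹ (fun _ => 1) g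

lemma gibbs_pos [Nonempty α] (τ : ℝ) (g : α → ℝ) : IsPosProb (gibbs τ g) :=
  mwu_pos _ _ (fun _ => one_pos) _

lemma exists_log_gibbs [Nonempty α] {τ : ℝ} (hτ : 0 < τ) (g : α → ℝ) :
    ∃ c, ∀ a, τ * Real.log (gibbs τ g a) = g a + c := by
  obtain ⟨c, hc⟩ := exists_log_mwu (α := α) τ τ⁻¹ (p := fun _ => 1) (fun _ => one_pos) g
  refine ⟨τ * c, fun a => ?_⟩
  rw [gibbs, hc, Real.log_one]
  field_simp
  ring

/-- If `τ log q = g + c` for a probability vector `q`, then `⟨p, g⟩ + τ H(p)` equals a constant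
minus `τ KL(p ‖ q)`, with the constant being the value at `q`. -/
lemma dotProduct_add_entropy_eq {τ c : ℝ} {p q g : α → ℝ} (hp : ∑ a, p a = 1)
    (hq : IsPosProb q) (h : ∀ a, τ * Real.log (q a) = g a + c) :
    p ⬝ᵥ g + τ * entropy p = q ⬝ᵥ g + τ * entropy q - τ * kl p q := by
  have key : ∀ r : α → ℝ, ∑ a, r a = 1 →
      r ⬝ᵥ g = τ * ∑ a, r a * Real.log (q a) - c := by
    intro r hr
    have : c = ∑ a, r a * c := by rw [← Finset.sum_mul, hr, one_mul]
    rw [this, Finset.mul_sum, ← Finset.sum_sub_distrib, dotProduct]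
    refine Finset.sum_congr rfl fun a _ => ?_
    linear_combination (-r a) * h a
  rw [key p hp, key q hq.2, kl_eq_sub hq.1, entropy, entropy]
  ring

lemma payoff_eq_left (A : Matrix α β ℝ) {τ c : ℝ} {μ μ' : α → ℝ} {ν : β → ℝ}
    (hμ : ∑ a, μ a = 1) (hμ' : IsPosProb μ')
    (h : ∀ a, τ * Real.log (μ' a) = (A *ᵥ ν) a + c) :
    payoff A τ μ ν = payoff A τ μ' ν - τ * kl μ μ' := by
  have := dotProduct_add_entropy_eq hμ hμ' h
  unfold payoff
  linarith

lemma payoff_eq_right (A : Matrix α β ℝ) {τ c : ℝ} {μ : α → ℝ} {ν ν' : β → ℝ}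
    (hν : ∑ b, ν b = 1) (hν' : IsPosProb ν')
    (h : ∀ b, τ * Real.log (ν' b) = (-(Aᵀ *ᵥ μ)) b + c) :
    payoff A τ μ ν = payoff A τ μ ν' + τ * kl ν ν' := by
  have := dotProduct_add_entropy_eq hν hν' h
  have e : ∀ r : β → ℝ, r ⬝ᵥ (-(Aᵀ *ᵥ μ)) = -(μ ⬝ᵥ (A *ᵥ r)) := fun r => by
    rw [dotProduct_neg, Matrix.mulVec_transpose, dotProduct_comm, Matrix.dotProduct_mulVec]
  rw [e, e] at this
  unfold payoff
  linarith

lemma payoff_gibbs_le (A : Matrix α β ℝ) {τ : ℝ} (hτ : 0 < τ) [Nonempty β] (μ : α → ℝ)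
    {ν : β → ℝ} (hν : ν ∈ stdSimplex ℝ β) :
    payoff A τ μ (gibbs τ (-(Aᵀ *ᵥ μ))) ≤ payoff A τ μ ν := by
  obtain ⟨c, hc⟩ := exists_log_gibbs hτ (-(Aᵀ *ᵥ μ))
  rw [payoff_eq_right A hν.2 (gibbs_pos τ _) hc]
  have := mul_nonneg hτ.le (kl_nonneg hν (gibbs_pos τ (-(Aᵀ *ᵥ μ))))
  linarith

lemma iInf_payoff_eq (A : Matrix α β ℝ) {τ : ℝ} (hτ : 0 < τ) [Nonempty β] (μ : α → ℝ) :
    ⨅ ν : stdSimplex ℝ β, payoff A τ μ ν = payoff A τ μ (gibbs τ (-(Aᵀ *ᵥ μ))) := by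
  have hne : Nonempty (stdSimplex ℝ β) := ⟨⟨_, (gibbs_pos τ (-(Aᵀ *ᵥ μ))).mem⟩⟩
  refine le_antisymm ?_ (le_ciInf fun ν => payoff_gibbs_le A hτ μ ν.2)
  exact ciInf_le (f := fun ν : stdSimplex ℝ β => payoff A τ μ ν)
    ⟨payoff A τ μ (gibbs τ (-(Aᵀ *ᵥ μ))), by rintro _ ⟨ν, rfl⟩; exact payoff_gibbs_le A hτ μ ν.2⟩
    ⟨_, (gibbs_pos τ (-(Aᵀ *ᵥ μ))).mem⟩

lemma concaveOn_entropy : ConcaveOn ℝ (stdSimplex ℝ α) (entropy : (α → ℝ) → ℝ) := by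
  refine ⟨convex_stdSimplex ℝ α, fun p hp q hq s t hs ht hst => ?_⟩
  have e : ∀ r : α → ℝ, entropy r = ∑ a, Real.negMulLog (r a) := fun r => by
    simp [entropy, Real.negMulLog]
  rw [e, e, e, Finset.smul_sum, Finset.smul_sum, ← Finset.sum_add_distrib]
  exact Finset.sum_le_sum fun a _ =>
    Real.concaveOn_negMulLog.2 (hp.1 a) (hq.1 a) hs ht hst

lemma continuous_entropy : Continuous (entropy : (α → ℝ) → ℝ) :=
  (continuous_finsetSum _ fun a _ => Real.continuous_mul_log.comp (continuous_apply a)).neg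

lemma continuous_payoff (A : Matrix α β ℝ) (τ : ℝ) :
    Continuous fun z : (α → ℝ) × (β → ℝ) => payoff A τ z.1 z.2 :=
  ((continuous_fst.dotProduct (continuous_const.matrix_mulVec continuous_snd)).add
    (continuous_const.mul (continuous_entropy.comp continuous_fst))).sub
    (continuous_const.mul (continuous_entropy.comp continuous_snd))

lemma add_payoff_le (A : Matrix α β ℝ) {τ : ℝ} (hτ : 0 < τ) {μ μ' : α → ℝ}
    (hμ : μ ∈ stdSimplex ℝ α) (hμ' : μ' ∈ stdSimplex ℝ α) (ν : β → ℝ) {s : ℝ} (hs : 0 ≤ s)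
    (hs1 : s ≤ 1) :
    (1 - s) * payoff A τ μ ν + s * payoff A τ μ' ν ≤ payoff A τ ((1 - s) • μ + s • μ') ν := by
  have h := mul_le_mul_of_nonneg_left
    (concaveOn_entropy.2 hμ hμ' (sub_nonneg.mpr hs1) hs (by ring)) hτ.le
  simp only [smul_eq_mul] at h
  simp only [payoff, add_dotProduct, smul_dotProduct, smul_eq_mul]
  linarith

/-- The max-min solution is a saddle point: the max player cannot improve against `ζ.2`. -/
lemma IsQRE.payoff_le {A : Matrix α β ℝ} {τ : ℝ} (hτ : 0 < τ) {ζ : (α → ℝ) × (β → ℝ)}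
    (h : IsQRE A τ ζ) [Nonempty β] (hζ : ζ.2 = gibbs τ (-(Aᵀ *ᵥ ζ.1))) {μ : α → ℝ}
    (hμ : μ ∈ stdSimplex ℝ α) : payoff A τ μ ζ.2 ≤ payoff A τ ζ.1 ζ.2 := by
  obtain ⟨h1, h2, hmax, hmin⟩ := h
  set P : ℝ → (α → ℝ) := fun s => (1 - s) • ζ.1 + s • μ with hP
  set N : ℝ → (β → ℝ) := fun s => gibbs τ (-(Aᵀ *ᵥ P s)) with hN
  have hPc : Continuous P := by fun_prop
  have hNc : Continuous N :=
    (continuous_mwu τ τ⁻¹ fun _ => one_pos).comp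
      (continuous_const.matrix_mulVec hPc).neg
  have hc : Continuous fun s => payoff A τ μ (N s) :=
    (continuous_payoff A τ).comp (continuous_const.prodMk hNc)
  have hN0 : N 0 = ζ.2 := by simp [hN, hP, ← hζ]
  -- Move from `ζ.1` towards `μ` by `s`, the opponent playing the best response `N s` to the moved
  -- point. Max-min optimality, concavity in the first argument and minimality of `ζ.2` against
  -- `ζ.1` bound the payoff of `μ` against `N s`. Letting `s → 0` gives the saddle inequality
  -- without a minimax theorem.
  have hle : ∀ s ∈ Set.Ioc (0 : ℝ) 1, payoff A τ μ (N s) ≤ payoff A τ ζ.1 ζ.2 := by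
    rintro s ⟨hs0, hs1⟩
    have hPs : P s ∈ stdSimplex ℝ α :=
      convex_stdSimplex ℝ α h1 hμ (sub_nonneg.mpr hs1) hs0.le (by ring)
    have e1 : payoff A τ (P s) (N s) ≤ payoff A τ ζ.1 ζ.2 := by
      have := hmax hPs
      simp only [Set.mem_ofPred_eq, iInf_payoff_eq A hτ] at this
      rwa [← hζ] at this
    have e2 : payoff A τ ζ.1 ζ.2 ≤ payoff A τ ζ.1 (N s) := hmin (gibbs_pos τ _).mem
    have e3 := add_payoff_le A hτ h1 hμ (N s) hs0.le hs1
    have e4 := mul_le_mul_of_nonneg_left e2 (sub_nonneg.mpr hs1)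
    have e5 : s * payoff A τ μ (N s) ≤ s * payoff A τ ζ.1 ζ.2 := by
      change _ ≤ payoff A τ (P s) (N s) at e3
      linarith
    exact le_of_mul_le_mul_left e5 hs0
  have hlim : Filter.Tendsto (fun s => payoff A τ μ (N s)) (nhdsWithin 0 (Set.Ioi 0))
      (nhds (payoff A τ μ ζ.2)) := by
    have := hc.tendsto 0
    rw [hN0] at this
    exact this.mono_left nhdsWithin_le_nhds
  refine le_of_tendsto hlim ?_
  filter_upwards [Ioc_mem_nhdsGT (zero_lt_one (α := ℝ))] with s hs using hle s hs

/-- The pair of fixed-point equations that characterizes the quantal response equilibrium. -/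
structure IsGibbsPair (A : Matrix α β ℝ) (τ : ℝ) (ζ : (α → ℝ) × (β → ℝ)) : Prop where
  fst_pos : IsPosProb ζ.1
  snd_pos : IsPosProb ζ.2
  fst_log : ∃ c, ∀ a, τ * Real.log (ζ.1 a) = (A *ᵥ ζ.2) a + c
  snd_log : ∃ c, ∀ b, τ * Real.log (ζ.2 b) = (-(Aᵀ *ᵥ ζ.1)) b + c

lemma IsQRE.isGibbsPair {A : Matrix α β ℝ} {τ : ℝ} (hτ : 0 < τ) {ζ : (α → ℝ) × (β → ℝ)}
    (h : IsQRE A τ ζ) : IsGibbsPair A τ ζ := by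
  have hα := nonempty_of_mem_stdSimplex h.1
  have hβ := nonempty_of_mem_stdSimplex h.2.1
  have hν : ζ.2 = gibbs τ (-(Aᵀ *ᵥ ζ.1)) := by
    obtain ⟨c, hc⟩ := exists_log_gibbs hτ (-(Aᵀ *ᵥ ζ.1))
    have hG := gibbs_pos τ (-(Aᵀ *ᵥ ζ.1))
    have e1 := payoff_eq_right A (ν := ζ.2) h.2.1.2 hG hc
    have e2 : payoff A τ ζ.1 ζ.2 ≤ payoff A τ ζ.1 (gibbs τ (-(Aᵀ *ᵥ ζ.1))) :=
      h.2.2.2 hG.mem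
    refine eq_of_kl_nonpos h.2.1 hG (nonpos_of_mul_nonpos_right ?_ hτ)
    linarith
  have hμ : ζ.1 = gibbs τ (A *ᵥ ζ.2) := by
    obtain ⟨c, hc⟩ := exists_log_gibbs hτ (A *ᵥ ζ.2)
    have hG := gibbs_pos τ (A *ᵥ ζ.2)
    have e1 := payoff_eq_left A (μ := ζ.1) h.1.2 hG hc
    have e2 := h.payoff_le hτ hν hG.mem
    refine eq_of_kl_nonpos h.1 hG (nonpos_of_mul_nonpos_right ?_ hτ)
    linarith
  refine ⟨?_, ?_, ?_, ?_⟩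
  · rw [hμ]; exact gibbs_pos _ _
  · rw [hν]; exact gibbs_pos _ _
  · obtain ⟨c, hc⟩ := exists_log_gibbs hτ (A *ᵥ ζ.2)
    exact ⟨c, fun a => by rw [← hc a, ← hμ]⟩
  · obtain ⟨c, hc⟩ := exists_log_gibbs hτ (-(Aᵀ *ᵥ ζ.1))
    exact ⟨c, fun b => by rw [← hc b, ← hν]⟩

/-- The payoff around a quantal response equilibrium. -/
lemma IsGibbsPair.payoff_sub {A : Matrix α β ℝ} {τ : ℝ} {ζs : (α → ℝ) × (β → ℝ)}
    (h : IsGibbsPair A τ ζs) {μ : α → ℝ} {ν : β → ℝ} (hμ : ∑ a, μ a = 1)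
    (hν : ∑ b, ν b = 1) :
    payoff A τ μ ν - payoff A τ ζs.1 ζs.2 =
      (μ - ζs.1) ⬝ᵥ (A *ᵥ (ν - ζs.2)) + τ * kl ν ζs.2 - τ * kl μ ζs.1 := by
  obtain ⟨c, hc⟩ := h.fst_log
  obtain ⟨d, hd⟩ := h.snd_log
  have e1 := payoff_eq_left A hμ h.fst_pos hc
  have e2 := payoff_eq_right A hν h.snd_pos hd
  have e3 : payoff A τ μ ν + payoff A τ ζs.1 ζs.2 - payoff A τ ζs.1 ν - payoff A τ μ ζs.2 =
      (μ - ζs.1) ⬝ᵥ (A *ᵥ (ν - ζs.2)) := by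
    simp only [payoff, Matrix.mulVec_sub, sub_dotProduct, dotProduct_sub]
    ring
  linarith

/-! ### One step of the extragradient updates -/

/-- Average the logarithmic relation under `q` and under `z` and subtract: both have mass one, so
the normalizing constant `c` cancels. -/
lemma dotProduct_log_update {p p' q g z : α → ℝ} {k c : ℝ} (hp : IsPosProb p)
    (hp' : IsPosProb p') (hq : IsPosProb q) (hz : ∑ a, z a = 1)
    (h : ∀ a, Real.log (p' a) = (1 - k) * Real.log (p a) + k * Real.log (q a) + g a + c) :
    (z - q) ⬝ᵥ g = kl q p' - (1 - k) * kl q p - kl z p' + (1 - k) * kl z p + k * kl z q := by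
  have key : ∀ r : α → ℝ, ∑ a, r a = 1 →
      ∑ a, r a * Real.log (p' a) = (1 - k) * ∑ a, r a * Real.log (p a)
        + k * ∑ a, r a * Real.log (q a) + r ⬝ᵥ g + c := by
    intro r hr
    have : c = ∑ a, r a * c := by rw [← Finset.sum_mul, hr, one_mul]
    rw [this, Finset.mul_sum, Finset.mul_sum, dotProduct, ← Finset.sum_add_distrib,
      ← Finset.sum_add_distrib, ← Finset.sum_add_distrib]
    refine Finset.sum_congr rfl fun a _ => ?_
    linear_combination (r a) * h a
  rw [sub_dotProduct, kl_eq_sub hp'.1, kl_eq_sub hp.1, kl_eq_sub hp'.1, kl_eq_sub hp.1,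
    kl_eq_sub hq.1]
  linear_combination key q hq.2 - key z hz

lemma kl_three_point {p p' g z : α → ℝ} {c : ℝ} (hp : IsPosProb p) (hp' : IsPosProb p')
    (hz : ∑ a, z a = 1) (h : ∀ a, Real.log (p' a) = Real.log (p a) + g a + c) :
    kl z p = kl z p' + kl p' p + (z - p') ⬝ᵥ g := by
  have := dotProduct_log_update (k := 0) hp hp' hp' hz (g := g) (c := c)
    (fun a => by rw [h a]; ring)
  rw [this, kl_self]
  ring

/-- Both components are probability vectors with positive entries. -/
def IsPosPair (ζ : (α → ℝ) × (β → ℝ)) : Prop := IsPosProb ζ.1 ∧ IsPosProb ζ.2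

lemma IsGibbsPair.isPosPair {A : Matrix α β ℝ} {τ : ℝ} {ζ : (α → ℝ) × (β → ℝ)}
    (h : IsGibbsPair A τ ζ) : IsPosPair ζ := ⟨h.fst_pos, h.snd_pos⟩

lemma IsPosPair.pairUpdate {ζ : (α → ℝ) × (β → ℝ)} (h : IsPosPair ζ) (A : Matrix α β ℝ)
    (τ η : ℝ) (z : (α → ℝ) × (β → ℝ)) : IsPosPair (pairUpdate A τ η ζ z) := by
  have := nonempty_of_mem_stdSimplex h.1.mem
  have := nonempty_of_mem_stdSimplex h.2.mem
  exact ⟨mwu_pos _ _ h.1.1 _, mwu_pos _ _ h.2.1 _⟩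

lemma klPair_nonneg {ζ ζ' : (α → ℝ) × (β → ℝ)} (h : IsPosPair ζ) (h' : IsPosPair ζ') :
    0 ≤ klPair ζ ζ' := add_nonneg (kl_nonneg h.1.mem h'.1) (kl_nonneg h.2.mem h'.2)

lemma klPair_self (ζ : (α → ℝ) × (β → ℝ)) : klPair ζ ζ = 0 := by
  rw [klPair, kl_self, kl_self, add_zero]

/-- The equilibrium equations trade the gradient at `z` for the gradient at `z - ζs` plus a pull of
weight `η τ` towards `ζs`. -/
lemma exists_log_pairUpdate {A : Matrix α β ℝ} {τ : ℝ} (η : ℝ) {ζs ζ : (α → ℝ) × (β → ℝ)}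
    (hs : IsGibbsPair A τ ζs) (hζ : IsPosPair ζ) (z : (α → ℝ) × (β → ℝ)) :
    (∃ c, ∀ a, Real.log ((pairUpdate A τ η ζ z).1 a) = (1 - η * τ) * Real.log (ζ.1 a)
      + η * τ * Real.log (ζs.1 a) + (η • A *ᵥ (z.2 - ζs.2)) a + c) ∧
    (∃ c, ∀ b, Real.log ((pairUpdate A τ η ζ z).2 b) = (1 - η * τ) * Real.log (ζ.2 b)
      + η * τ * Real.log (ζs.2 b) + (-(η • Aᵀ *ᵥ (z.1 - ζs.1))) b + c) := by
  have := nonempty_of_mem_stdSimplex hζ.1.mem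
  have := nonempty_of_mem_stdSimplex hζ.2.mem
  obtain ⟨c, hc⟩ := hs.fst_log
  obtain ⟨d, hd⟩ := hs.snd_log
  obtain ⟨c', hc'⟩ := exists_log_mwu τ η hζ.1.1 (A *ᵥ z.2)
  obtain ⟨d', hd'⟩ := exists_log_mwu τ η hζ.2.1 (-(Aᵀ *ᵥ z.1))
  refine ⟨⟨c' - η * c, fun a => ?_⟩, ⟨d' - η * d, fun b => ?_⟩⟩
  · have := hc a
    simp only [pairUpdate, hc', Matrix.mulVec_sub, Pi.smul_apply, Pi.sub_apply, smul_eq_mul]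
    linear_combination (-η) * this
  · have := hd b
    simp only [pairUpdate, hd', Matrix.mulVec_sub, Pi.smul_apply, Pi.sub_apply, smul_eq_mul,
      Pi.neg_apply] at this ⊢
    linear_combination (-η) * this

/-- An equality because the game is zero-sum: the gradient terms of the two players, paired with `z
- ζs`, cancel. Only the last term on the right obstructs contraction. -/
lemma klPair_pairUpdate {A : Matrix α β ℝ} {τ : ℝ} (η : ℝ) {ζs ζ z : (α → ℝ) × (β → ℝ)}
    (hs : IsGibbsPair A τ ζs) (hζ : IsPosPair ζ) (hz : IsPosPair z) :
    klPair ζs (pairUpdate A τ η ζ z) + (1 - η * τ) * klPair z ζ + η * τ * klPair z ζs =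
      (1 - η * τ) * klPair ζs ζ + klPair z (pairUpdate A τ η ζ z) := by
  obtain ⟨⟨c, hc⟩, ⟨d, hd⟩⟩ := exists_log_pairUpdate η hs hζ z
  have hu := hζ.pairUpdate A τ η z
  have e1 := dotProduct_log_update hζ.1 hu.1 hs.fst_pos hz.1.2 hc
  have e2 := dotProduct_log_update hζ.2 hu.2 hs.snd_pos hz.2.2 hd
  have e3 : (z.1 - ζs.1) ⬝ᵥ (η • A *ᵥ (z.2 - ζs.2)) +
      (z.2 - ζs.2) ⬝ᵥ (-(η • Aᵀ *ᵥ (z.1 - ζs.1))) = 0 := by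
    rw [dotProduct_neg, dotProduct_smul, dotProduct_smul, Matrix.mulVec_transpose,
      dotProduct_comm (z.2 - ζs.2), Matrix.dotProduct_mulVec]
    ring
  unfold klPair
  linarith

/-- The bilinear coupling of the `ℓ¹` norms of two pairs. -/
def cross (u v : (α → ℝ) × (β → ℝ)) : ℝ := l1 u.1 * l1 v.2 + l1 u.2 * l1 v.1

/-- Half of the sum of the squared `ℓ¹` norms. -/
noncomputable def halfSq (u : (α → ℝ) × (β → ℝ)) : ℝ := (l1 u.1 ^ 2 + l1 u.2 ^ 2) / 2

lemma cross_le (u v : (α → ℝ) × (β → ℝ)) : cross u v ≤ halfSq u + halfSq v := by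
  unfold cross halfSq
  linarith [two_mul_le_add_sq (l1 u.1) (l1 v.2), two_mul_le_add_sq (l1 u.2) (l1 v.1)]

lemma cross_add_le (u v w : (α → ℝ) × (β → ℝ)) : cross u (v + w) ≤ cross u v + cross u w := by
  have h1 := mul_le_mul_of_nonneg_left (l1_add_le v.2 w.2) (l1_nonneg u.1)
  have h2 := mul_le_mul_of_nonneg_left (l1_add_le v.1 w.1) (l1_nonneg u.2)
  simp only [cross, Prod.fst_add, Prod.snd_add]
  linarith

lemma halfSq_sub_comm (u v : (α → ℝ) × (β → ℝ)) : halfSq (u - v) = halfSq (v - u) := by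
  simp only [halfSq, Prod.fst_sub, Prod.snd_sub, l1_sub_comm u.1, l1_sub_comm u.2]

lemma halfSq_sub_le_klPair {ζ ζ' : (α → ℝ) × (β → ℝ)} (h : IsPosPair ζ) (h' : IsPosPair ζ') :
    halfSq (ζ - ζ') ≤ klPair ζ ζ' := by
  have h1 := sq_l1_sub_le_two_mul_kl h.1.mem h'.1
  have h2 := sq_l1_sub_le_two_mul_kl h.2.mem h'.2
  simp only [halfSq, klPair, Prod.fst_sub, Prod.snd_sub]
  linarith

/-- Two updates from the same `ζ` have log-ratio `η A (z - w)` up to sign and a constant, so the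
three-point identity leaves only a bilinear remainder. Taking `x = z` with `z` the update at `w`
controls the obstruction in `klPair_pairUpdate`; taking `x = ζs` transfers the bound from `ζ'` to
the midpoint. -/
lemma abs_klPair_pairUpdate_sub_le {A : Matrix α β ℝ} {τ η : ℝ} (hη : 0 ≤ η)
    {ζ z w x : (α → ℝ) × (β → ℝ)} (hζ : IsPosPair ζ) (hx : IsPosPair x) :
    |klPair x (pairUpdate A τ η ζ w) - klPair x (pairUpdate A τ η ζ z)
      - klPair (pairUpdate A τ η ζ z) (pairUpdate A τ η ζ w)|
      ≤ η * maxNorm A * cross (x - pairUpdate A τ η ζ z) (z - w) := by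
  have := nonempty_of_mem_stdSimplex hζ.1.mem
  have := nonempty_of_mem_stdSimplex hζ.2.mem
  obtain ⟨c, hc⟩ := exists_log_mwu τ η hζ.1.1 (A *ᵥ z.2)
  obtain ⟨d, hd⟩ := exists_log_mwu τ η hζ.2.1 (-(Aᵀ *ᵥ z.1))
  obtain ⟨c', hc'⟩ := exists_log_mwu τ η hζ.1.1 (A *ᵥ w.2)
  obtain ⟨d', hd'⟩ := exists_log_mwu τ η hζ.2.1 (-(Aᵀ *ᵥ w.1))
  have hz := hζ.pairUpdate A τ η z
  have hw := hζ.pairUpdate A τ η w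
  have e1 := kl_three_point (g := η • A *ᵥ (z.2 - w.2)) (c := c - c') hw.1 hz.1 hx.1.2
    (fun a => by
      simp only [pairUpdate, hc, hc', Matrix.mulVec_sub, Pi.smul_apply, Pi.sub_apply,
        smul_eq_mul]
      ring)
  have e2 := kl_three_point (g := -(η • Aᵀ *ᵥ (z.1 - w.1))) (c := d - d') hw.2 hz.2 hx.2.2
    (fun a => by
      simp only [pairUpdate, hd, hd', Matrix.mulVec_sub, Pi.smul_apply, Pi.sub_apply,
        smul_eq_mul, Pi.neg_apply]
      ring)
  have b1 := mul_le_mul_of_nonneg_left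
    (abs_dotProduct_mulVec_le A (x.1 - (pairUpdate A τ η ζ z).1) (z.2 - w.2)) hη
  have b2 := mul_le_mul_of_nonneg_left
    (abs_dotProduct_mulVec_le Aᵀ (x.2 - (pairUpdate A τ η ζ z).2) (z.1 - w.1)) hη
  rw [← abs_of_nonneg hη, ← abs_mul, abs_of_nonneg hη] at b1 b2
  rw [maxNorm_transpose] at b2
  rw [dotProduct_smul, smul_eq_mul] at e1
  rw [dotProduct_neg, dotProduct_smul, smul_eq_mul] at e2
  simp only [klPair, cross, Prod.fst_sub, Prod.snd_sub]
  rw [abs_le] at b1 b2 ⊢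
  constructor <;> linarith

/-! ### Contraction of the two methods -/

/-- The bounds on the Kullback-Leibler divergences shared by both methods. -/
structure KLBounds (r k K : ℝ) (ζs : (α → ℝ) × (β → ℝ)) (ζ ζbar : ℕ → (α → ℝ) × (β → ℝ)) :
    Prop where
  iterate_le : ∀ t, klPair ζs (ζ t) ≤ r ^ t * K
  midpoint_le : ∀ t, klPair ζs (ζbar (t + 1)) ≤ 2 * (r ^ (t + 1) * K)
  reverse_le : ∀ t, k * klPair (ζbar (t + 1)) ζs ≤ r ^ (t + 1) * K

section Step

variable {A : Matrix α β ℝ} {τ η : ℝ} {ζs ζ w : (α → ℝ) × (β → ℝ)}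

/-- With `x = η ‖A‖` and `k = η τ`, Pinsker gives `KL(z ‖ ζ') ≤ x KL(z ‖ ζ) - (1 - x) KL(ζ' ‖ z)`.
Hence `KL(ζs ‖ ζ') + (1 - k - x) KL(z ‖ ζ) + (1 - x) KL(ζ' ‖ z) + k KL(z ‖ ζs) ≤ (1 - k) KL(ζs ‖
ζ)`. Dropping terms gives the first and third claims; twice this inequality dominates the
three-point bound on `KL(ζs ‖ z)`. -/
lemma pu_step (hs : IsGibbsPair A τ ζs) (hτ : 0 < τ) (hη : 0 < η)
    (hstep : η * τ + 2 * (η * maxNorm A) ≤ 1) (hζ : IsPosPair ζ) :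
    let z := pairUpdate A τ η ζ ζ
    let ζ' := pairUpdate A τ η ζ z
    klPair ζs ζ' ≤ (1 - η * τ) * klPair ζs ζ ∧
    klPair ζs z ≤ 2 * ((1 - η * τ) * klPair ζs ζ) ∧
    η * τ * klPair z ζs ≤ (1 - η * τ) * klPair ζs ζ := by
  intro z ζ'
  have hz : IsPosPair z := hζ.pairUpdate A τ η ζ
  have hζ' : IsPosPair ζ' := hζ.pairUpdate A τ η z
  have e1 := klPair_pairUpdate η hs hζ hz
  have e2 := abs_klPair_pairUpdate_sub_le (A := A) (τ := τ) hη.le (z := z) (w := ζ) hζ hz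
  have e3 := abs_klPair_pairUpdate_sub_le (A := A) (τ := τ) hη.le (z := z) (w := ζ) hζ hs.isPosPair
  change klPair ζs ζ' + _ + _ = _ + klPair z ζ' at e1
  change |klPair z z - klPair z ζ' - klPair ζ' z| ≤ _ * cross (z - ζ') _ at e2
  change |klPair ζs z - klPair ζs ζ' - klPair ζ' z| ≤ _ * cross (ζs - ζ') _ at e3
  have hx : 0 ≤ η * maxNorm A := mul_nonneg hη.le (maxNorm_nonneg A)
  have hk : 0 < η * τ := mul_pos hη hτ
  have n1 := klPair_nonneg hz hζ
  have n2 := klPair_nonneg hζ' hz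
  have n3 := klPair_nonneg hz hs.isPosPair
  have n4 := klPair_nonneg hs.isPosPair hζ'
  have q1 := halfSq_sub_le_klPair hz hζ
  have q2 := halfSq_sub_le_klPair hζ' hz
  have q4 := halfSq_sub_le_klPair hs.isPosPair hζ'
  rw [halfSq_sub_comm] at q2
  have c2 := mul_le_mul_of_nonneg_left
    ((cross_le (z - ζ') (z - ζ)).trans (add_le_add q2 q1)) hx
  have c3 := mul_le_mul_of_nonneg_left
    ((cross_le (ζs - ζ') (z - ζ)).trans (add_le_add q4 q1)) hx
  rw [klPair_self, abs_le] at e2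
  rw [abs_le] at e3
  have m1 := mul_nonneg (by linarith : 0 ≤ 1 - η * τ - 2 * (η * maxNorm A)) n1
  have m2 := mul_nonneg (by linarith : 0 ≤ 1 - 2 * (η * maxNorm A)) n2
  have m4 := mul_nonneg (by linarith : 0 ≤ 1 - 2 * (η * maxNorm A)) n4
  have l1 := mul_nonneg hx n1
  have l2 := mul_nonneg hx n2
  have l3 := mul_nonneg hk.le n3
  refine ⟨?_, ?_, ?_⟩ <;> linarith

/-- Here `z` was computed from the old midpoint `w`, so `z - w` is split at `ζ`, which costs an
extra `η ‖A‖ KL(ζ ‖ w)`. The weight in `V` is the coefficient of `KL(ζ' ‖ z)` that survives on the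
left, and `KL(ζ' ‖ z)` is the corresponding term of the next step. -/
lemma omwu_step (hs : IsGibbsPair A τ ζs) (hτ : 0 < τ) (hη : 0 < η)
    (hstep : 2 * (η * τ) + 2 * (η * maxNorm A) ≤ 1) (hstep' : 4 * (η * maxNorm A) ≤ 1)
    (hζ : IsPosPair ζ) (hw : IsPosPair w) :
    let z := pairUpdate A τ η ζ w
    let ζ' := pairUpdate A τ η ζ z
    let V := klPair ζs ζ + (1 - 2 * (η * maxNorm A)) * klPair ζ w
    klPair ζs ζ' + (1 - 2 * (η * maxNorm A)) * klPair ζ' z ≤ (1 - η * τ) * V ∧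
    klPair ζs z ≤ 2 * ((1 - η * τ) * V) ∧
    η * τ * klPair z ζs ≤ (1 - η * τ) * V := by
  intro z ζ' V
  have hz : IsPosPair z := hζ.pairUpdate A τ η w
  have hζ' : IsPosPair ζ' := hζ.pairUpdate A τ η z
  have e1 := klPair_pairUpdate η hs hζ hz
  have e2 := abs_klPair_pairUpdate_sub_le (A := A) (τ := τ) hη.le (z := z) (w := w) hζ hz
  have e3 := abs_klPair_pairUpdate_sub_le (A := A) (τ := τ) hη.le (z := z) (w := w) hζ hs.isPosPair
  change klPair ζs ζ' + _ + _ = _ + klPair z ζ' at e1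
  change |klPair z z - klPair z ζ' - klPair ζ' z| ≤ _ * cross (z - ζ') _ at e2
  change |klPair ζs z - klPair ζs ζ' - klPair ζ' z| ≤ _ * cross (ζs - ζ') _ at e3
  have hx : 0 ≤ η * maxNorm A := mul_nonneg hη.le (maxNorm_nonneg A)
  have hk : 0 < η * τ := mul_pos hη hτ
  have n0 := klPair_nonneg hζ hw
  have n1 := klPair_nonneg hz hζ
  have n2 := klPair_nonneg hζ' hz
  have n3 := klPair_nonneg hz hs.isPosPair
  have n4 := klPair_nonneg hs.isPosPair hζ'
  have q0 := halfSq_sub_le_klPair hζ hw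
  have q1 := halfSq_sub_le_klPair hz hζ
  have q2 := halfSq_sub_le_klPair hζ' hz
  have q4 := halfSq_sub_le_klPair hs.isPosPair hζ'
  rw [halfSq_sub_comm] at q2
  have hcross : ∀ u : (α → ℝ) × (β → ℝ), η * maxNorm A * cross u (z - w) ≤
      η * maxNorm A * (2 * halfSq u + klPair z ζ + klPair ζ w) := fun u => by
    refine mul_le_mul_of_nonneg_left ?_ hx
    have h := cross_add_le u (z - ζ) (ζ - w)
    rw [sub_add_sub_cancel] at h
    linarith [cross_le u (z - ζ), cross_le u (ζ - w)]
  have c2 := hcross (z - ζ')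
  have c3 := hcross (ζs - ζ')
  have d2 := mul_le_mul_of_nonneg_left q2 hx
  have d4 := mul_le_mul_of_nonneg_left q4 hx
  rw [klPair_self, abs_le] at e2
  rw [abs_le] at e3
  -- With `x = η ‖A‖`, the midpoint bound needs `3x` of `KL(ζ ‖ w)`: `2x` from doubling the
  -- contraction estimate, `x` from the comparison at `ζs`. As `1 - η τ ≥ 1/2 + x`, the right side
  -- is at least `1 - 4x²`, and `1 - 4x² - 3x = (1 - 4x)(1 + x)`: this is where `4x ≤ 1` enters.
  have hcoef : 3 * (η * maxNorm A) ≤ 2 * ((1 - η * τ) * (1 - 2 * (η * maxNorm A))) := by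
    nlinarith [mul_nonneg (by linarith : 0 ≤ 1 - 2 * (η * τ) - 2 * (η * maxNorm A))
      (by linarith : 0 ≤ 1 - 2 * (η * maxNorm A)), mul_nonneg hx
      (by linarith : 0 ≤ 1 - 4 * (η * maxNorm A))]
  have m0 := mul_le_mul_of_nonneg_right hcoef n0
  have m1 := mul_nonneg (by linarith : 0 ≤ 1 - η * τ - η * maxNorm A) n1
  have m1' := mul_nonneg (by linarith : 0 ≤ 1 - 2 * (η * τ) - 2 * (η * maxNorm A)) n1
  have m2 := mul_nonneg (by linarith : 0 ≤ 1 - 4 * (η * maxNorm A)) n2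
  have m4 := mul_nonneg (by linarith : 0 ≤ 1 - 4 * (η * maxNorm A)) n4
  have l0 := mul_nonneg hx n0
  have l1 := mul_nonneg hx n1
  have l1' := mul_nonneg hk.le n1
  have l3 := mul_nonneg hk.le n3
  have hV : (1 - η * τ) * V = (1 - η * τ) * klPair ζs ζ +
      (1 - η * τ) * (1 - 2 * (η * maxNorm A)) * klPair ζ w := by simp only [V]; ring
  rw [hV]
  refine ⟨?_, ?_, ?_⟩ <;> linarith

end Step

section Methods

variable {A : Matrix α β ℝ} {τ η : ℝ} {ζs : (α → ℝ) × (β → ℝ)}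
  {ζ ζbar : ℕ → (α → ℝ) × (β → ℝ)}

lemma isPosPair_iterate (h0 : IsPosPair (ζ 0))
    (hζ : ∀ t, ζ (t + 1) = pairUpdate A τ η (ζ t) (ζbar (t + 1))) (t : ℕ) :
    IsPosPair (ζ t) := by
  induction t with
  | zero => exact h0
  | succ t ih => rw [hζ]; exact ih.pairUpdate _ _ _ _

lemma KLBounds.of_lyapunov {r k K : ℝ} (hr : 0 ≤ r) (V : ℕ → ℝ) (hV0 : V 0 = K)
    (hV : ∀ t, V (t + 1) ≤ r * V t) (h1 : ∀ t, klPair ζs (ζ t) ≤ V t)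
    (h2 : ∀ t, klPair ζs (ζbar (t + 1)) ≤ 2 * (r * V t))
    (h3 : ∀ t, k * klPair (ζbar (t + 1)) ζs ≤ r * V t) : KLBounds r k K ζs ζ ζbar := by
  have hVt : ∀ t, V t ≤ r ^ t * K := fun t => by
    induction t with
    | zero => simp [hV0]
    | succ t ih =>
      refine (hV t).trans ((mul_le_mul_of_nonneg_left ih hr).trans_eq ?_)
      ring
  have hVt' : ∀ t, r * V t ≤ r ^ (t + 1) * K := fun t =>
    (mul_le_mul_of_nonneg_left (hVt t) hr).trans_eq (by ring)
  exact ⟨fun t => (h1 t).trans (hVt t), fun t => (h2 t).trans (by linarith [hVt' t]),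
    fun t => (h3 t).trans (hVt' t)⟩

lemma IsPU.klBounds (h : IsPU A τ η ζ ζbar) (hs : IsGibbsPair A τ ζs) (h0 : IsPosPair (ζ 0))
    (hτ : 0 < τ) (hη : 0 < η) (hstep : η * τ + 2 * (η * maxNorm A) ≤ 1) :
    KLBounds (1 - η * τ) (η * τ) (klPair ζs (ζ 0)) ζs ζ ζbar := by
  have hx : 0 ≤ η * maxNorm A := mul_nonneg hη.le (maxNorm_nonneg A)
  have hst := fun t =>
    pu_step hs hτ hη hstep (isPosPair_iterate h0 (fun t => (h t).2) t)
  refine .of_lyapunov (by linarith) (fun t => klPair ζs (ζ t)) rfl ?_ (fun _ => le_rfl) ?_ ?_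
  · intro t
    have := (hst t).1
    rwa [← (h t).1, ← (h t).2] at this
  · intro t
    have := (hst t).2.1
    rwa [← (h t).1] at this
  · intro t
    have := (hst t).2.2
    rwa [← (h t).1] at this

lemma IsOMWU.klBounds (h : IsOMWU A τ η ζ ζbar) (hs : IsGibbsPair A τ ζs)
    (h0 : IsPosPair (ζ 0)) (hτ : 0 < τ) (hη : 0 < η)
    (hstep : 2 * (η * τ) + 2 * (η * maxNorm A) ≤ 1) (hstep' : 4 * (η * maxNorm A) ≤ 1) :
    KLBounds (1 - η * τ) (η * τ) (klPair ζs (ζ 0)) ζs ζ ζbar := by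
  obtain ⟨hb0, h⟩ := h
  have hx : 0 ≤ η * maxNorm A := mul_nonneg hη.le (maxNorm_nonneg A)
  have hpos := isPosPair_iterate h0 (fun t => (h t).2)
  have hbpos : ∀ t, IsPosPair (ζbar t) := fun t => by
    cases t with
    | zero => rw [hb0]; exact h0
    | succ t => rw [(h t).1]; exact (hpos t).pairUpdate _ _ _ _
  have hst := fun t => omwu_step hs hτ hη hstep hstep' (hpos t) (hbpos t)
  refine .of_lyapunov (by linarith [mul_pos hη hτ])
    (fun t => klPair ζs (ζ t) + (1 - 2 * (η * maxNorm A)) * klPair (ζ t) (ζbar t)) ?_ ?_ ?_ ?_ ?_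
  -- The start `ζbar 0 = ζ 0` makes the extra Lyapunov term vanish initially.
  · rw [hb0, klPair_self]; ring
  · intro t
    have := (hst t).1
    rwa [← (h t).1, ← (h t).2] at this
  · intro t
    have := mul_nonneg (by linarith : 0 ≤ 1 - 2 * (η * maxNorm A))
      (klPair_nonneg (hpos t) (hbpos t))
    linarith
  · intro t
    have := (hst t).2.1
    rwa [← (h t).1] at this
  · intro t
    have := (hst t).2.2
    rwa [← (h t).1] at this

end Methods

/-! ### Optimality and duality gaps -/

section Gaps

variable {A : Matrix α β ℝ} {τ : ℝ} {ζs z : (α → ℝ) × (β → ℝ)}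

lemma optGap_le (hs : IsGibbsPair A τ ζs) (hτ : 0 < τ) (hz : IsPosPair z) :
    optGap A τ ζs z ≤ maxNorm A * klPair ζs z + τ * klPair z ζs := by
  have h1 := halfSq_sub_le_klPair hs.isPosPair hz
  rw [halfSq_sub_comm] at h1
  have h2 : |(z.1 - ζs.1) ⬝ᵥ (A *ᵥ (z.2 - ζs.2))| ≤ maxNorm A * klPair ζs z := by
    refine (abs_dotProduct_mulVec_le A _ _).trans
      (mul_le_mul_of_nonneg_left (le_trans ?_ h1) (maxNorm_nonneg A))
    simp only [halfSq, Prod.fst_sub, Prod.snd_sub]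
    linarith [two_mul_le_add_sq (l1 (z.1 - ζs.1)) (l1 (z.2 - ζs.2))]
  have h3 := mul_nonneg hτ.le (kl_nonneg hz.1.mem hs.fst_pos)
  have h4 := mul_nonneg hτ.le (kl_nonneg hz.2.mem hs.snd_pos)
  rw [optGap, hs.payoff_sub hz.1.2 hz.2.2]
  have e : τ * klPair z ζs = τ * kl z.1 ζs.1 + τ * kl z.2 ζs.2 := by rw [klPair, mul_add]
  rw [e]
  rw [abs_le] at h2 ⊢
  constructor <;> linarith

lemma mul_mul_le_of_sq_le {M d e k k' : ℝ} (hτ : 0 < τ) (hd : d ^ 2 ≤ 2 * k)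
    (he : e ^ 2 ≤ 2 * k') : M * (d * e) ≤ τ⁻¹ * M ^ 2 * k + τ * k' := by
  have h1 := mul_le_mul_of_nonneg_left hd (mul_nonneg (inv_pos.mpr hτ).le (sq_nonneg M))
  have h2 := mul_le_mul_of_nonneg_left he hτ.le
  have h3 := mul_nonneg (inv_pos.mpr hτ).le (sq_nonneg (M * d - τ * e))
  have e3 : τ⁻¹ * (M * d - τ * e) ^ 2 =
      τ⁻¹ * M ^ 2 * d ^ 2 - 2 * (M * (d * e)) + τ * e ^ 2 := by
    field_simp
    ring
  linarith

/-- A deviation `μ` is far from equilibrium only at the cost `τ KL(μ ‖ ζs.1)`. Young's inequality,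
weighted by `τ`, makes the bilinear term pay for exactly that cost, so the bound is uniform in the
deviation; likewise for the other player. -/
lemma dualGap_le (hs : IsGibbsPair A τ ζs) (hτ : 0 < τ) (hz : IsPosPair z) :
    dualGap A τ z ≤ τ⁻¹ * maxNorm A ^ 2 * klPair ζs z + τ * klPair z ζs := by
  have : Nonempty (stdSimplex ℝ α) := ⟨⟨_, hz.1.mem⟩⟩
  have : Nonempty (stdSimplex ℝ β) := ⟨⟨_, hz.2.mem⟩⟩
  have h1 : ⨆ μ : stdSimplex ℝ α, payoff A τ μ z.2 ≤ payoff A τ ζs.1 ζs.2 +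
      (τ⁻¹ * maxNorm A ^ 2 * kl ζs.2 z.2 + τ * kl z.2 ζs.2) := by
    refine ciSup_le fun ⟨μ, hμ⟩ => ?_
    change payoff A τ μ z.2 ≤ _
    have e1 := hs.payoff_sub hμ.2 hz.2.2
    have e2 := (le_abs_self _).trans (abs_dotProduct_mulVec_le A (μ - ζs.1) (z.2 - ζs.2))
    have hd := sq_l1_sub_le_two_mul_kl hs.snd_pos.mem hz.2
    rw [l1_sub_comm] at hd
    have he := sq_l1_sub_le_two_mul_kl hμ hs.fst_pos
    have := mul_mul_le_of_sq_le (M := maxNorm A) hτ hd he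
    rw [mul_comm (l1 (z.2 - ζs.2))] at this
    linarith
  have h2 : payoff A τ ζs.1 ζs.2 - (τ⁻¹ * maxNorm A ^ 2 * kl ζs.1 z.1 + τ * kl z.1 ζs.1) ≤
      ⨅ ν : stdSimplex ℝ β, payoff A τ z.1 ν := by
    refine le_ciInf fun ⟨ν, hν⟩ => ?_
    change _ ≤ payoff A τ z.1 ν
    have e1 := hs.payoff_sub hz.1.2 hν.2
    have e2 := (neg_le_abs _).trans (abs_dotProduct_mulVec_le A (z.1 - ζs.1) (ν - ζs.2))
    have hd := sq_l1_sub_le_two_mul_kl hs.fst_pos.mem hz.1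
    rw [l1_sub_comm] at hd
    have he := sq_l1_sub_le_two_mul_kl hν hs.snd_pos
    have := mul_mul_le_of_sq_le (M := maxNorm A) hτ hd he
    linarith
  unfold dualGap klPair
  linarith

end Gaps

/-! ### Entrywise convergence of the log-ratios -/

/-- Two vectors of equal mass have log-ratios of both signs (in the weak sense), which forces `|c| ≤
B`. The unknown normalizing constant thus costs only a factor `2`. -/
lemma abs_log_div_le {p q : α → ℝ} (hp : IsPosProb p) (hq : IsPosProb q) {c B : ℝ}
    (h : ∀ a, |Real.log (p a / q a) - c| ≤ B) (a : α) : |Real.log (p a / q a)| ≤ 2 * B := by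
  have : Nonempty α := ⟨a⟩
  obtain ⟨i, -, hi⟩ := Finset.exists_le_of_sum_le (f := q) (g := p) Finset.univ_nonempty
    (by rw [hp.2, hq.2])
  obtain ⟨j, -, hj⟩ := Finset.exists_le_of_sum_le (f := p) (g := q) Finset.univ_nonempty
    (by rw [hp.2, hq.2])
  have hi' : 0 ≤ Real.log (p i / q i) := Real.log_nonneg ((one_le_div (hq.1 i)).mpr hi)
  have hj' : Real.log (p j / q j) ≤ 0 :=
    Real.log_nonpos (div_nonneg (hp.1 j).le (hq.1 j).le) ((div_le_one (hq.1 j)).mpr hj)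
  have ha := abs_le.mp (h a)
  have hi2 := abs_le.mp (h i)
  have hj2 := abs_le.mp (h j)
  rw [abs_le]
  constructor <;> linarith

lemma exists_abs_log_div_sub_le {p p' q g : α → ℝ} {k c B D : ℝ} (hp : IsPosProb p)
    (hp' : IsPosProb p') (hq : IsPosProb q) (hk : k ≤ 1)
    (h : ∀ a, Real.log (p' a) = (1 - k) * Real.log (p a) + k * Real.log (q a) + g a + c)
    (hg : ∀ a, |g a| ≤ D) (hB : ∃ c, ∀ a, |Real.log (p a / q a) - c| ≤ B) :
    ∃ c, ∀ a, |Real.log (p' a / q a) - c| ≤ (1 - k) * B + D := by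
  obtain ⟨d, hd⟩ := hB
  refine ⟨(1 - k) * d + c, fun a => ?_⟩
  have e : Real.log (p' a / q a) - ((1 - k) * d + c) =
      (1 - k) * (Real.log (p a / q a) - d) + g a := by
    rw [Real.log_div (hp'.1 a).ne' (hq.1 a).ne', Real.log_div (hp.1 a).ne' (hq.1 a).ne', h a]
    ring
  rw [e]
  refine (abs_add_le _ _).trans (add_le_add ?_ (hg a))
  rw [abs_mul, abs_of_nonneg (sub_nonneg.mpr hk)]
  exact mul_le_mul_of_nonneg_left (hd a) (sub_nonneg.mpr hk)

lemma abs_smul_mulVec_le {η : ℝ} (hη : 0 ≤ η) (A : Matrix α β ℝ) {v : β → ℝ} {S k : ℝ}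
    (hv : l1 v ≤ 2 * (S * k)) (a : α) :
    |(η • A *ᵥ v) a| ≤ η * maxNorm A * k * (2 * S) := by
  rw [Pi.smul_apply, smul_eq_mul, abs_mul, abs_of_nonneg hη]
  have h := (abs_mulVec_le A v a).trans (mul_le_mul_of_nonneg_left hv (maxNorm_nonneg A))
  exact (mul_le_mul_of_nonneg_left h hη).trans_eq (by ring)

section LogRatio

variable {A : Matrix α β ℝ} {τ η K : ℝ} {ζs : (α → ℝ) × (β → ℝ)}
  {ζ ζbar : ℕ → (α → ℝ) × (β → ℝ)}

lemma l1_sub_le_of_klPair_le {z : (α → ℝ) × (β → ℝ)} (hs : IsPosPair ζs) (hz : IsPosPair z)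
    {d : ℝ} (hd : 0 ≤ d) (h : klPair ζs z ≤ 2 * d ^ 2) :
    l1 (z.1 - ζs.1) ≤ 2 * d ∧ l1 (z.2 - ζs.2) ≤ 2 * d := by
  have h1 := sq_l1_sub_le_two_mul_kl hs.1.mem hz.1
  have h2 := sq_l1_sub_le_two_mul_kl hs.2.mem hz.2
  have n1 := kl_nonneg hs.1.mem hz.1
  have n2 := kl_nonneg hs.2.mem hz.2
  rw [l1_sub_comm] at h1 h2
  unfold klPair at h
  constructor <;> refine (abs_le_of_sq_le_sq' ?_ (by linarith)).2 <;> linarith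

/-- Induction step for the ansatz `s^(2t) W + C s^t`, with `S = s^t`. After division by `C s S` it
reads `s + (1 - s²)/2 ≤ 1`, that is `(1 - s)² ≥ 0`. -/
lemma logRatio_bound_step {r s C x S : ℝ} (hs0 : 0 ≤ s) (hsr : s ^ 2 = r)
    (hC : 0 ≤ C) (hx : 4 * x = (1 - r) * C) (hS : 0 ≤ S) (W : ℝ) :
    r * (S ^ 2 * W + C * S) + x * (2 * (s * S)) ≤ (s * S) ^ 2 * W + C * (s * S) := by
  have h := mul_nonneg (mul_nonneg hC (mul_nonneg hs0 hS)) (sq_nonneg (1 - s))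
  have hx' : x = (1 - s ^ 2) * C / 4 := by rw [hsr]; linarith
  rw [hx', ← hsr]
  nlinarith

lemma norm_logRatio_le (hs : IsGibbsPair A τ ζs) (hτ : 0 < τ) (hη : 0 < η) (hk : η * τ ≤ 1)
    (h0 : IsPosPair (ζ 0)) (hbar : ∀ t, IsPosPair (ζbar (t + 1)))
    (hζ : ∀ t, ζ (t + 1) = pairUpdate A τ η (ζ t) (ζbar (t + 1))) (hK : 0 ≤ K)
    (hb : ∀ t, klPair ζs (ζbar (t + 1)) ≤ 2 * ((1 - η * τ) ^ (t + 1) * K)) (t : ℕ) :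
    ‖logRatio (ζ t) ζs‖ ≤ 2 * (1 - η * τ) ^ t * ‖logRatio (ζ 0) ζs‖
      + 8 * maxNorm A / τ * (1 - η * τ) ^ ((t : ℝ) / 2) * √K := by
  set r := 1 - η * τ with hr
  set s := √r with hs'
  set W := ‖logRatio (ζ 0) ζs‖ with hW
  set C := 4 * maxNorm A / τ * √K with hC'
  have hr0 : 0 ≤ r := sub_nonneg.mpr hk
  have hs0 : 0 ≤ s := Real.sqrt_nonneg r
  have hsr : s ^ 2 = r := Real.sq_sqrt hr0
  have hM := maxNorm_nonneg A
  have hC : 0 ≤ C := by positivity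
  have hpos := isPosPair_iterate h0 hζ
  have key : ∀ t, (∃ c, ∀ a, |Real.log ((ζ t).1 a / ζs.1 a) - c| ≤ (s ^ t) ^ 2 * W + C * s ^ t) ∧
      (∃ c, ∀ b, |Real.log ((ζ t).2 b / ζs.2 b) - c| ≤ (s ^ t) ^ 2 * W + C * s ^ t) := by
    intro t
    induction t with
    | zero =>
      refine ⟨⟨0, fun a => ?_⟩, ⟨0, fun b => ?_⟩⟩
      · have h1 := (norm_le_pi_norm (logRatio (ζ 0) ζs).1 a).trans (norm_fst_le _)
        rw [Real.norm_eq_abs] at h1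
        simp only [logRatio] at h1
        simp only [sub_zero, pow_zero, one_pow, one_mul, mul_one]
        exact h1.trans (le_add_of_nonneg_right hC)
      · have h1 := (norm_le_pi_norm (logRatio (ζ 0) ζs).2 b).trans (norm_snd_le _)
        rw [Real.norm_eq_abs] at h1
        simp only [logRatio] at h1
        simp only [sub_zero, pow_zero, one_pow, one_mul, mul_one]
        exact h1.trans (le_add_of_nonneg_right hC)
    | succ t ih =>
      obtain ⟨⟨c, hc⟩, ⟨d, hd⟩⟩ := exists_log_pairUpdate η hs (hpos t) (ζbar (t + 1))
      have hu := hpos (t + 1)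
      have hd0 : 0 ≤ s ^ (t + 1) * √K := by positivity
      -- The choice `d = s^(t+1) √K` gives `d² = r^(t+1) K`, so the midpoint divergence is at most
      -- `2 d²` and Pinsker yields `2 d`.
      obtain ⟨l1b, l2b⟩ := l1_sub_le_of_klPair_le hs.isPosPair (hbar t) hd0 (by
        refine (hb t).trans_eq ?_
        rw [mul_pow, Real.sq_sqrt hK, ← pow_mul, mul_comm (t + 1) 2, pow_mul, hsr])
      have hstep := logRatio_bound_step hs0 hsr hC (x := η * maxNorm A * √K)
        (by rw [hC', hr]; field_simp; ring) (pow_nonneg hs0 t) W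
      rw [← pow_succ'] at hstep
      rw [← hζ] at hc hd
      constructor
      · obtain ⟨c', hc'⟩ := exists_abs_log_div_sub_le (hpos t).1 hu.1 hs.fst_pos hk hc
          (fun a => abs_smul_mulVec_le hη.le A l2b a) ih.1
        exact ⟨c', fun a => (hc' a).trans hstep⟩
      · obtain ⟨c', hc'⟩ := exists_abs_log_div_sub_le
          (D := η * maxNorm A * √K * (2 * s ^ (t + 1))) (hpos t).2 hu.2 hs.snd_pos hk hd
          (fun b => by
            rw [Pi.neg_apply, abs_neg, ← maxNorm_transpose A]
            exact abs_smul_mulVec_le hη.le Aᵀ l1b b) ih.2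
        exact ⟨c', fun a => (hc' a).trans hstep⟩
  obtain ⟨⟨c, hc⟩, ⟨d, hd⟩⟩ := key t
  -- Only `0 ≤ r` is available: `r = 0` occurs when `η τ = 1`.
  have hrpow : r ^ ((t : ℝ) / 2) = s ^ t := by
    rw [hs', Real.sqrt_eq_rpow, ← Real.rpow_natCast, ← Real.rpow_mul hr0]
    congr 1
    ring
  have hB : 2 * ((s ^ t) ^ 2 * W + C * s ^ t) = 2 * r ^ t * W
      + 8 * maxNorm A / τ * r ^ ((t : ℝ) / 2) * √K := by
    rw [hrpow, ← hsr, hC']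
    ring
  rw [← hB]
  have hW0 : 0 ≤ W := norm_nonneg _
  have hB0 : 0 ≤ 2 * ((s ^ t) ^ 2 * W + C * s ^ t) := by positivity
  rw [norm_prod_le_iff, pi_norm_le_iff_of_nonneg hB0, pi_norm_le_iff_of_nonneg hB0]
  exact ⟨fun a => abs_log_div_le (hpos t).1 hs.fst_pos hc a,
    fun b => abs_log_div_le (hpos t).2 hs.snd_pos hd b⟩

end LogRatio

/-! ### Rates for the gaps at the midpoints -/

lemma KLBounds.gaps_le {A : Matrix α β ℝ} {τ η K : ℝ} {ζs : (α → ℝ) × (β → ℝ)}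
    {ζ ζbar : ℕ → (α → ℝ) × (β → ℝ)} (h : KLBounds (1 - η * τ) (η * τ) K ζs ζ ζbar)
    (hs : IsGibbsPair A τ ζs) (hτ : 0 < τ) (hη : 0 < η) (hk : η * τ ≤ 1)
    (hx : 2 * (η * maxNorm A) ≤ 1) (hbar : ∀ t, IsPosPair (ζbar (t + 1))) (hK : 0 ≤ K) (t : ℕ) :
    optGap A τ ζs (ζbar (t + 1)) ≤ 3 * η⁻¹ * (1 - η * τ) ^ (t + 1) * K ∧
    dualGap A τ (ζbar (t + 1)) ≤
      (η⁻¹ + 2 * τ⁻¹ * maxNorm A ^ 2) * (1 - η * τ) ^ t * K := by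
  have hr : 0 ≤ 1 - η * τ := sub_nonneg.mpr hk
  have hη' : 0 < η⁻¹ := inv_pos.mpr hη
  have hτ' : 0 < τ⁻¹ := inv_pos.mpr hτ
  have hM := maxNorm_nonneg A
  have hR : 0 ≤ (1 - η * τ) ^ (t + 1) * K := by positivity
  have h1 := h.midpoint_le t
  have h2 : τ * klPair (ζbar (t + 1)) ζs ≤ η⁻¹ * ((1 - η * τ) ^ (t + 1) * K) := by
    have := mul_le_mul_of_nonneg_left (h.reverse_le t) hη'.le
    rwa [← mul_assoc, ← mul_assoc, inv_mul_cancel₀ hη.ne', one_mul] at this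
  have hMη : 2 * maxNorm A ≤ η⁻¹ := by
    rw [← one_div, le_div_iff₀ hη]
    linarith
  constructor
  -- The bilinear and the entropic part contribute `η⁻¹` each; the constant `3` leaves slack.
  · refine (optGap_le hs hτ (hbar t)).trans ?_
    have h3 := mul_le_mul_of_nonneg_left h1 hM
    have h4 := mul_le_mul_of_nonneg_right hMη hR
    have h5 := mul_nonneg hη'.le hR
    linarith
  · refine (dualGap_le hs hτ (hbar t)).trans ?_
    have h3 := mul_le_mul_of_nonneg_left h1 (mul_nonneg hτ'.le (sq_nonneg (maxNorm A)))
    have h4 : (1 - η * τ) ^ (t + 1) * K ≤ (1 - η * τ) ^ t * K := by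
      refine mul_le_mul_of_nonneg_right ?_ hK
      exact pow_le_pow_of_le_one hr (by linarith [mul_pos hη hτ]) t.le_succ
    have h5 := mul_le_mul_of_nonneg_left h4
      (by positivity : 0 ≤ η⁻¹ + 2 * τ⁻¹ * maxNorm A ^ 2)
    linarith

end EntropyGame

/-! ### Assembly of the bounds for both methods -/

theorem mainTheorem1 {α β : Type*} [Fintype α] [Fintype β]
    (A : Matrix α β ℝ) (τ : ℝ) (hτ : 0 < τ)
    (ζs : (α → ℝ) × (β → ℝ)) (hζs : EntropyGame.IsQRE A τ ζs)
    (η : ℝ) (hη : 0 < η)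
    (ζ ζbar : ℕ → (α → ℝ) × (β → ℝ))
    -- the initial policies are probability vectors with positive entries
    (hμ0 : (ζ 0).1 ∈ stdSimplex ℝ α) (hμ0pos : ∀ a, 0 < (ζ 0).1 a)
    (hν0 : (ζ 0).2 ∈ stdSimplex ℝ β) (hν0pos : ∀ b, 0 < (ζ 0).2 b)
    -- `4 * η * ‖A‖ ≤ 1` is `η ≤ 1 / (4 ‖A‖)`, read as no condition when `A = 0`
    (hrun : (EntropyGame.IsPU A τ η ζ ζbar ∧ η ≤ 1 / (τ + 2 * EntropyGame.maxNorm A)) ∨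
      (EntropyGame.IsOMWU A τ η ζ ζbar ∧
        η ≤ 1 / (2 * τ + 2 * EntropyGame.maxNorm A) ∧ 4 * η * EntropyGame.maxNorm A ≤ 1)) :
    ∀ t : ℕ,
      max (EntropyGame.klPair ζs (ζ t)) (1 / 2 * EntropyGame.klPair ζs (ζbar (t + 1)))
          ≤ (1 - η * τ) ^ t * EntropyGame.klPair ζs (ζ 0) ∧
      ‖EntropyGame.logRatio (ζ t) ζs‖
          ≤ 2 * (1 - η * τ) ^ t * ‖EntropyGame.logRatio (ζ 0) ζs‖
            + 8 * EntropyGame.maxNorm A / τ * (1 - η * τ) ^ ((t : ℝ) / 2)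
              * √(EntropyGame.klPair ζs (ζ 0)) ∧
      EntropyGame.optGap A τ ζs (ζbar (t + 1))
          ≤ 3 * η⁻¹ * (1 - η * τ) ^ (t + 1) * EntropyGame.klPair ζs (ζ 0) ∧
      EntropyGame.dualGap A τ (ζbar (t + 1))
          ≤ (η⁻¹ + 2 * τ⁻¹ * EntropyGame.maxNorm A ^ 2) * (1 - η * τ) ^ t
            * EntropyGame.klPair ζs (ζ 0) := by
  have hs := hζs.isGibbsPair hτ
  have h0 : EntropyGame.IsPosPair (ζ 0) := ⟨⟨hμ0pos, hμ0.2⟩, ⟨hν0pos, hν0.2⟩⟩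
  have hM := EntropyGame.maxNorm_nonneg A
  have hK := EntropyGame.klPair_nonneg hs.isPosPair h0
  have hupd : ∀ t, ζ (t + 1) = EntropyGame.pairUpdate A τ η (ζ t) (ζbar (t + 1)) :=
    hrun.elim (fun h t => (h.1 t).2) fun h t => (h.1.2 t).2
  have hpos := EntropyGame.isPosPair_iterate h0 hupd
  have hbar : ∀ t, EntropyGame.IsPosPair (ζbar (t + 1)) := fun t => by
    rcases hrun with ⟨h, -⟩ | ⟨⟨-, h⟩, -⟩ <;> rw [(h t).1] <;> exact (hpos t).pairUpdate _ _ _ _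
  -- The OMWU step condition implies the PU one, so from here on the two methods are treated
  -- together.
  obtain ⟨hstep, hB⟩ : η * τ + 2 * (η * EntropyGame.maxNorm A) ≤ 1 ∧
      EntropyGame.KLBounds (1 - η * τ) (η * τ) (EntropyGame.klPair ζs (ζ 0)) ζs ζ ζbar := by
    rcases hrun with ⟨h, h1⟩ | ⟨h, h1, h2⟩
    · rw [le_div_iff₀ (by linarith)] at h1
      have hstep : η * τ + 2 * (η * EntropyGame.maxNorm A) ≤ 1 := by linarith
      exact ⟨hstep, h.klBounds hs h0 hτ hη hstep⟩
    · rw [le_div_iff₀ (by linarith)] at h1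
      exact ⟨by linarith [mul_pos hη hτ],
        h.klBounds hs h0 hτ hη (by linarith) (by linarith)⟩
  have hητ := mul_pos hη hτ
  have hx := mul_nonneg hη.le hM
  have hk : η * τ ≤ 1 := by linarith
  intro t
  refine ⟨max_le (hB.iterate_le t) ?_,
    EntropyGame.norm_logRatio_le hs hτ hη hk h0 hbar hupd hK hB.midpoint_le t,
    hB.gaps_le hs hτ hη hk (by linarith) hbar hK t⟩
  have h1 := hB.midpoint_le t
  have h2 : (1 - η * τ) ^ (t + 1) * EntropyGame.klPair ζs (ζ 0) ≤
      (1 - η * τ) ^ t * EntropyGame.klPair ζs (ζ 0) :=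
    mul_le_mul_of_nonneg_right
      (pow_le_pow_of_le_one (sub_nonneg.mpr hk) (by linarith) t.le_succ) hK
  linarith
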